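/- Let $k$ be a field of characteristic $0$, let $p\ge 2$ and $d\ge 1$ be integers, and let $n_i=n_0+id$ $(0\le i\le p)$ be an arithmetic sequence of positive integers with $\gcd(n_0,\dots,n_p)=1$. Assume that the sequence is minimal, i.e. $n_0,\dots,n_p$ is a minimal generating set of the numerical semigroup it generates (no $n_i$ is a sum, with repetitions allowed, of the others). Write $n_0=ap+b$ with integers $a,b$ and $0\le b<p$. Let $$S=\langle (0,n_p),(n_0,n_p-n_0),(n_1,n_p-n_1),\dots,(n_{p-1},n_p-n_{p-1}),(n_p,0)\rangle\subseteq\mathbb N^2$$ and let $k[S]=\bigoplus_{(x,y)\in S}k\,t^xu^y\subseteq k[t,u]$ be its semigroup ring. All the derivations of $k[t,u]$ listed below map $k[S]$ into itself in the respective case, and their restrictions to $k[S]$ minimally generate the $k[S]$-module $\mathrm{Der}_k(k[S])$ of $k$-derivations of $k[S]$ (they generate it, and no proper subset of the list does): 1. If $b=0$: $$\left\{u\tfrac{\partial}{\partial u},\ t^{an_p+d}u^{(d-1)(n_p-1)}\tfrac{\partial}{\partial u},\ t\tfrac{\partial}{\partial t}\right\}\cup\left\{t^{an_p-n_{p-i}+1}u^{d(n_p-i)}\tfrac{\partial}{\partial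 t}\ \middle|\ 1\le i\le p-1\right\}.$$ 2. If $b=1$: $$\left\{u\tfrac{\partial}{\partial u},\ t^{an_p+d}u^{(d-1)(n_p-1)}\tfrac{\partial}{\partial u},\ t\tfrac{\partial}{\partial t}\right\}\cup\left\{t^{an_p-n_{p-i}+1}u^{d(n_p-i)}\tfrac{\partial}{\partial t}\ \middle|\ 1\le i\le p\right\}.$$ 3. If $b\notin\{0,1\}$: $$\left\{u\tfrac{\partial}{\partial u},\ t^{(a+1)n_p+d}u^{(d-1)(n_p-1)}\tfrac{\partial}{\partial u},\ t\tfrac{\partial}{\partial t}\right\}\cup\left\{t^{an_p+id+1}u^{d(n_p-i)}\tfrac{\partial}{\partial t}\ \middle|\ 1\le i\le b-1\right\}.$$ -/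

import Mathlib

open MvPolynomial

/-- `n 0, …, n p` is a minimal generating set of the submonoid of `ℕ` that it generates:
no `n i` lies in the submonoid generated by the `n j` with `j ≠ i`. -/
def IsMinimalSeq (p : ℕ) (n : ℕ → ℕ) : Prop :=
  ∀ i ≤ p, n i ∉ AddSubmonoid.closure {m : ℕ | ∃ j ≤ p, j ≠ i ∧ m = n j}

/-- The affine semigroup in `ℕ²` generated by `(0, n p)`, the pairs `(n i, n p - n i)` for
`0 ≤ i < p`, and `(n p, 0)`. It is used only when `n i ≤ n p` for `i ≤ p`. -/
def projSemigroup (p : ℕ) (n : ℕ → ℕ) : AddSubmonoid (ℕ × ℕ) :=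
  AddSubmonoid.closure
    ({(0, n p), (n p, 0)} ∪ {s : ℕ × ℕ | ∃ i < p, s = (n i, n p - n i)})

/-- The semigroup ring `k[S] = ⊕_{s ∈ S} k t^{s.1} u^{s.2}`, as a subalgebra of the polynomial
ring `k[t, u]` with `t = X 0` and `u = X 1`: the polynomials all of whose monomials have
exponents in `S`. -/
noncomputable def semigroupRing (k : Type*) [Field k] (S : AddSubmonoid (ℕ × ℕ)) :
    Subalgebra k (MvPolynomial (Fin 2) k) where
  carrier := {f | ∀ m ∈ f.support, (m 0, m 1) ∈ S}
  mul_mem' := by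
    classical
    intro f g hf hg m hm
    obtain ⟨x, hx, y, hy, rfl⟩ := Finset.mem_add.mp (support_mul f g hm)
    exact S.add_mem (hf x hx) (hg y hy)
  add_mem' := by
    classical
    intro f g hf hg m hm
    rcases Finset.mem_union.mp (support_add hm) with h | h
    · exact hf m h
    · exact hg m h
  algebraMap_mem' := by
    intro r m hm
    have h0 : m = 0 := by
      by_contra h
      rw [mem_support_iff, algebraMap_eq, coeff_C, if_neg (Ne.symm h)] at hm
      exact hm rfl
    subst h0
    exact S.zero_mem

/-- The derivation `t^x u^y ∂/∂t` of `k[t, u]`. -/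
noncomputable def derT (k : Type*) [Field k] (x y : ℕ) :
    Derivation k (MvPolynomial (Fin 2) k) (MvPolynomial (Fin 2) k) :=
  ((X 0 : MvPolynomial (Fin 2) k) ^ x * X 1 ^ y) • pderiv 0

/-- The derivation `t^x u^y ∂/∂u` of `k[t, u]`. -/
noncomputable def derU (k : Type*) [Field k] (x y : ℕ) :
    Derivation k (MvPolynomial (Fin 2) k) (MvPolynomial (Fin 2) k) :=
  ((X 0 : MvPolynomial (Fin 2) k) ^ x * X 1 ^ y) • pderiv 1

/-- The derivations of the subalgebra `A` that are restrictions of members of `Y`. -/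
def restrictions {k : Type*} [Field k] (A : Subalgebra k (MvPolynomial (Fin 2) k))
    (Y : Set (Derivation k (MvPolynomial (Fin 2) k) (MvPolynomial (Fin 2) k))) :
    Set (Derivation k A A) :=
  {E | ∃ D ∈ Y, ∀ f : A, (E f : MvPolynomial (Fin 2) k) = D f}

/-- The set `Y` of `k`-derivations of the `k`-algebra `B` generates the `B`-module `Der_k(B)`. -/
def GeneratesDer (k : Type*) {B : Type*} [Field k] [CommRing B] [Algebra k B]
    (Y : Set (Derivation k B B)) : Prop :=
  Submodule.span B Y = ⊤

/-- The `A`-module `Der_k(A)` is minimally generated by (the restrictions to `A` of) the set `Y`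
of derivations of `k[t, u]`: every member of `Y` maps `A` into itself, the restrictions generate
`Der_k(A)` as an `A`-module, and the restrictions of the members of a proper subset of `Y` never
do. -/
def MinimallyGeneratesDer {k : Type*} [Field k] (A : Subalgebra k (MvPolynomial (Fin 2) k))
    (Y : Set (Derivation k (MvPolynomial (Fin 2) k) (MvPolynomial (Fin 2) k))) : Prop :=
  (∀ D ∈ Y, ∀ f ∈ A, D f ∈ A) ∧
  GeneratesDer k (restrictions A Y) ∧
  ∀ Z, Z ⊂ Y → ¬ GeneratesDer k (restrictions A Z)

/-! Write N = n_p. A derivation of k[S] splits into finitely many homogeneous parts. The part of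
degree v multiplies t^x u^y by t^(v.1) u^(v.2) and by a scalar additive in (x, y). Since N(x, y) =
x(N, 0) + y(0, N), that scalar is αx + βy (`exists_linear_coeff`). If α and β are both nonzero, then
v + (N, 0) and v + (0, N) lie in S, hence v does (`mem_of_add_mem`, the Cohen–Macaulay property). So
the ∂/∂t and ∂/∂u parts preserve k[S] separately, and Der is described by two sets of degrees, each
stable under adding S. Minimal generators of Der are the minimal elements of these sets
(`minimallyGeneratesDer_of_degrees`).

The degrees are found by a normal form. As N and d are coprime, an integer is uniquely jN - gd with
0 ≤ g < N. A point with this first coordinate and total degree mN lies in S iff g ≤ jp and j ≤ m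
(`mem_iff`). Besides the degrees in S, generated by t∂/∂t and u∂/∂u, this leaves for ∂/∂t only j =
J, where Jp < N - 1 ≤ (J + 1)p, with finitely many g and m ≥ J. For ∂/∂u it leaves g = N - 1, j = m
+ 1 ≥ J + 1. The least m gives the listed generators. The three cases on b arise from N = (a + d)p +
b, which makes J = a + d - 1 for b ≤ 1 and J = a + d otherwise. -/

/-! ### Monomials and coefficients with exponents in ℤ² -/

/-- The inclusion of `ℕ²` into `ℤ²`. -/
def toZZ : ℕ × ℕ →+ ℤ × ℤ := (Nat.castAddMonoidHom ℤ).prodMap (Nat.castAddMonoidHom ℤ)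

lemma toZZ_apply (s : ℕ × ℕ) : toZZ s = ((s.1 : ℤ), (s.2 : ℤ)) := rfl

lemma toZZ_injective : Function.Injective toZZ := by
  rintro ⟨a, b⟩ ⟨c, e⟩ h
  simp only [toZZ_apply, Prod.mk.injEq, Nat.cast_inj] at h
  exact Prod.ext h.1 h.2

/-- The exponent vector `(s.1, s.2)`. -/
noncomputable def expo (s : ℕ × ℕ) : Fin 2 →₀ ℕ := Finsupp.single 0 s.1 + Finsupp.single 1 s.2

@[simp] lemma expo_zero_apply (s : ℕ × ℕ) : expo s 0 = s.1 := by simp [expo]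

@[simp] lemma expo_one_apply (s : ℕ × ℕ) : expo s 1 = s.2 := by simp [expo]

lemma expo_eta (m : Fin 2 →₀ ℕ) : expo (m 0, m 1) = m := by
  ext i; fin_cases i <;> simp

lemma expo_injective : Function.Injective expo := fun s s' h => by
  refine Prod.ext ?_ ?_
  · simpa using DFunLike.congr_fun h 0
  · simpa using DFunLike.congr_fun h 1

lemma expo_add (s s' : ℕ × ℕ) : expo (s + s') = expo s + expo s' := by
  ext i; fin_cases i <;> simp

section
variable {k : Type*} [Field k]

/-- The monomial `t^{s.1} u^{s.2}`. -/
noncomputable def mono (k : Type*) [Field k] (s : ℕ × ℕ) : MvPolynomial (Fin 2) k :=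
  monomial (expo s) 1

/-- The coefficient of a polynomial at an exponent in `ℤ²`, zero outside `ℕ²`. -/
noncomputable def zcoeff (w : ℤ × ℤ) : MvPolynomial (Fin 2) k →ₗ[k] k :=
  if 0 ≤ w.1 ∧ 0 ≤ w.2 then lcoeff k (expo (w.1.toNat, w.2.toNat)) else 0

lemma zcoeff_toZZ (s : ℕ × ℕ) (f : MvPolynomial (Fin 2) k) :
    zcoeff (toZZ s) f = coeff (expo s) f := by
  simp [zcoeff, toZZ_apply]

lemma eq_toZZ {w : ℤ × ℤ} (h : 0 ≤ w.1 ∧ 0 ≤ w.2) : ∃ s, w = toZZ s :=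
  ⟨(w.1.toNat, w.2.toNat), by
    rw [toZZ_apply]; ext <;> simp [h.1, h.2]⟩

lemma eq_toZZ_of_zcoeff_ne_zero {w : ℤ × ℤ} {f : MvPolynomial (Fin 2) k} (h : zcoeff w f ≠ 0) :
    ∃ s, w = toZZ s := by
  by_cases hw : 0 ≤ w.1 ∧ 0 ≤ w.2
  · exact eq_toZZ hw
  · simp [zcoeff, hw] at h

lemma zcoeff_ext {f g : MvPolynomial (Fin 2) k} (h : ∀ w, zcoeff w f = zcoeff w g) : f = g := by
  ext m
  have := h (toZZ (m 0, m 1))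
  rwa [zcoeff_toZZ, zcoeff_toZZ, expo_eta] at this

lemma zcoeff_mono (s : ℕ × ℕ) (w : ℤ × ℤ) :
    zcoeff w (mono k s) = if w = toZZ s then 1 else 0 := by
  classical
  by_cases hw : 0 ≤ w.1 ∧ 0 ≤ w.2
  · obtain ⟨r, rfl⟩ := eq_toZZ hw
    rw [zcoeff_toZZ, mono, coeff_monomial]
    simp only [expo_injective.eq_iff, toZZ_injective.eq_iff, eq_comm]
  · rw [if_neg]
    · simp [zcoeff, hw]
    · rintro rfl
      exact hw (by simp [toZZ_apply])

/-- Allowing exponents in ℤ² makes the shift unconditional: no divisibility case is needed, and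
degrees of derivations may have negative entries. -/
lemma zcoeff_mono_mul (s : ℕ × ℕ) (f : MvPolynomial (Fin 2) k) (w : ℤ × ℤ) :
    zcoeff w (mono k s * f) = zcoeff (w - toZZ s) f := by
  classical
  by_cases hw : 0 ≤ w.1 ∧ 0 ≤ w.2
  · obtain ⟨r, rfl⟩ := eq_toZZ hw
    rw [zcoeff_toZZ, mono, coeff_monomial_mul', one_mul]
    split_ifs with hle
    · have h0 := hle 0
      have h1 := hle 1
      simp only [expo_zero_apply, expo_one_apply] at h0 h1
      obtain ⟨q, rfl⟩ : ∃ q, r = s + q :=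
        ⟨(r.1 - s.1, r.2 - s.2), by ext <;> simp <;> omega⟩
      rw [map_add, add_sub_cancel_left, zcoeff_toZZ, expo_add, add_tsub_cancel_left]
    · by_contra hne
      obtain ⟨q, hq⟩ := eq_toZZ_of_zcoeff_ne_zero (Ne.symm hne)
      have : r = s + q := toZZ_injective (by rw [map_add, ← hq]; abel)
      exact hle (by rw [this, expo_add]; exact le_self_add)
  · have h2 : ¬ (0 ≤ (w - toZZ s).1 ∧ 0 ≤ (w - toZZ s).2) := by
      simp only [toZZ_apply, Prod.fst_sub, Prod.snd_sub]
      omega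
    rw [zcoeff, zcoeff, if_neg hw, if_neg h2]
    rfl

lemma mono_add (s s' : ℕ × ℕ) : mono k (s + s') = mono k s * mono k s' := by
  simp [mono, expo_add, monomial_mul]

lemma exists_zcoeff_of_mul {f g : MvPolynomial (Fin 2) k} {w : ℤ × ℤ}
    (h : zcoeff w (f * g) ≠ 0) :
    ∃ w₁ w₂, w = w₁ + w₂ ∧ zcoeff w₁ f ≠ 0 ∧ zcoeff w₂ g ≠ 0 := by
  classical
  obtain ⟨s, rfl⟩ := eq_toZZ_of_zcoeff_ne_zero h
  rw [zcoeff_toZZ, ← mem_support_iff] at h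
  obtain ⟨x, hx, y, hy, hxy⟩ := Finset.mem_add.mp (support_mul f g h)
  refine ⟨toZZ (x 0, x 1), toZZ (y 0, y 1), ?_, ?_, ?_⟩
  · rw [← map_add]
    congr 1
    apply expo_injective
    rw [← hxy, expo_add, expo_eta, expo_eta]
  · rwa [zcoeff_toZZ, expo_eta, ← mem_support_iff]
  · rwa [zcoeff_toZZ, expo_eta, ← mem_support_iff]

lemma mem_semigroupRing {S : AddSubmonoid (ℕ × ℕ)} {f : MvPolynomial (Fin 2) k} :
    f ∈ semigroupRing k S ↔ ∀ w, zcoeff w f ≠ 0 → w ∈ S.map toZZ := by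
  constructor
  · intro hf w hw
    obtain ⟨s, rfl⟩ := eq_toZZ_of_zcoeff_ne_zero hw
    rw [zcoeff_toZZ, ← mem_support_iff] at hw
    have := hf _ hw
    simp only [expo_zero_apply, expo_one_apply] at this
    exact ⟨s, this, rfl⟩
  · intro h m hm
    obtain ⟨s, hs, hsm⟩ := h (toZZ (m 0, m 1))
      (by rwa [zcoeff_toZZ, expo_eta, ← mem_support_iff])
    rwa [← toZZ_injective hsm]

lemma mono_mem {S : AddSubmonoid (ℕ × ℕ)} {s : ℕ × ℕ} (hs : s ∈ S) :
    mono k s ∈ semigroupRing k S := by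
  rw [mem_semigroupRing]
  intro w hw
  rw [zcoeff_mono] at hw
  simp only [ne_eq, ite_eq_right_iff, one_ne_zero, imp_false, not_not] at hw
  exact ⟨s, hs, hw.symm⟩

lemma eq_sum_mono (f : MvPolynomial (Fin 2) k) :
    f = ∑ m ∈ f.support, coeff m f • mono k (m 0, m 1) := by
  conv_lhs => rw [f.as_sum]
  refine Finset.sum_congr rfl fun m _ => ?_
  rw [mono, expo_eta, smul_monomial, smul_eq_mul, mul_one]

/-- Two linear maps on the semigroup ring that agree on its monomials are equal. -/
lemma linearMap_ext_mono {S : AddSubmonoid (ℕ × ℕ)} {M : Type*} [AddCommMonoid M] [Module k M]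
    {F G : semigroupRing k S →ₗ[k] M}
    (h : ∀ (s : ℕ × ℕ) (hs : s ∈ S), F ⟨mono k s, mono_mem hs⟩ = G ⟨mono k s, mono_mem hs⟩) :
    F = G := by
  ext f
  have hf : f = ∑ m : f.1.support, coeff m.1 f.1 •
      (⟨mono k (m.1 0, m.1 1), mono_mem (f.2 m.1 m.2)⟩ : semigroupRing k S) := by
    apply Subtype.ext
    rw [AddSubmonoidClass.coe_finsetSum]
    conv_lhs => rw [eq_sum_mono f.1]
    rw [← Finset.sum_coe_sort]
    rfl
  rw [hf]
  simp only [map_sum, map_smul]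
  exact Finset.sum_congr rfl fun m _ => by rw [h _ (f.2 m.1 m.2)]

/-- The restriction of a derivation to a subalgebra that it preserves. -/
def restrictDer {B : Type*} [CommRing B] [Algebra k B] (A : Subalgebra k B)
    (D : Derivation k B B) (h : ∀ f ∈ A, D f ∈ A) : Derivation k A A :=
  Derivation.mk' ((D : B →ₗ[k] B).restrict (p := A.toSubmodule) (q := A.toSubmodule) h) (by
    intro f g
    apply Subtype.ext
    change D (f.1 * g.1) = f.1 * D g.1 + g.1 * D f.1
    rw [D.leibniz]; rfl)

lemma restrictDer_coe {B : Type*} [CommRing B] [Algebra k B] (A : Subalgebra k B)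
    (D : Derivation k B B) (h : ∀ f ∈ A, D f ∈ A) (f : A) : (restrictDer A D h f : B) = D f := rfl

noncomputable instance (S : AddSubmonoid (ℕ × ℕ)) :
    Module (semigroupRing k S) (Derivation k (semigroupRing k S) (semigroupRing k S)) :=
  Derivation.instModule

noncomputable instance (S : AddSubmonoid (ℕ × ℕ)) :
    SMul (semigroupRing k S) (Derivation k (semigroupRing k S) (semigroupRing k S)) :=
  Module.toDistribMulAction.toSMul

/-! ### Homogeneous derivations and the degree criterion -/

/-- A derivation is homogeneous of degree `v` with weights `φ` when it sends `t^x u^y` to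
`φ (x, y) t^x u^y` shifted by `v`. -/
def IsHomogDer (D : Derivation k (MvPolynomial (Fin 2) k) (MvPolynomial (Fin 2) k))
    (v : ℤ × ℤ) (φ : ℕ × ℕ → k) : Prop :=
  ∀ s w, zcoeff w (D (mono k s)) = if w = toZZ s + v then φ s else 0

lemma mono_eq_X (x y : ℕ) : (X 0 : MvPolynomial (Fin 2) k) ^ x * X 1 ^ y = mono k (x, y) := by
  rw [X_pow_eq_monomial, X_pow_eq_monomial, monomial_mul, mono, expo, one_mul]

lemma isHomogDer_derT (x y : ℕ) :
    IsHomogDer (derT k x y) ((x : ℤ) - 1, (y : ℤ)) (fun s => (s.1 : k)) := by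
  rintro ⟨s₁, s₂⟩ w
  have h : derT k x y (mono k (s₁, s₂)) = (s₁ : k) • mono k (x + (s₁ - 1), y + s₂) := by
    rw [derT, Derivation.smul_apply, mono_eq_X, smul_eq_mul, mono, mono, pderiv_monomial]
    have : expo (s₁, s₂) - Finsupp.single 0 1 = expo (s₁ - 1, s₂) := by
      ext i; fin_cases i <;> simp
    rw [this, one_mul, expo_zero_apply, monomial_mul, mono, smul_monomial, ← expo_add]
    simp
  rw [h, map_smul, zcoeff_mono]
  -- The truncated exponent s₁ - 1 is wrong only at s₁ = 0, where the coefficient vanishes.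
  rcases Nat.eq_zero_or_pos s₁ with h0 | h0
  · subst h0; simp
  · have e : toZZ (x + (s₁ - 1), y + s₂) = toZZ (s₁, s₂) + ((x : ℤ) - 1, (y : ℤ)) := by
      simp only [toZZ_apply, Prod.mk_add_mk, Prod.mk.injEq]
      omega
    simp [e]

lemma isHomogDer_derU (x y : ℕ) :
    IsHomogDer (derU k x y) ((x : ℤ), (y : ℤ) - 1) (fun s => (s.2 : k)) := by
  rintro ⟨s₁, s₂⟩ w
  have h : derU k x y (mono k (s₁, s₂)) = (s₂ : k) • mono k (x + s₁, y + (s₂ - 1)) := by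
    rw [derU, Derivation.smul_apply, mono_eq_X, smul_eq_mul, mono, mono, pderiv_monomial]
    have : expo (s₁, s₂) - Finsupp.single 1 1 = expo (s₁, s₂ - 1) := by
      ext i; fin_cases i <;> simp
    rw [this, one_mul, expo_one_apply, monomial_mul, mono, smul_monomial, ← expo_add]
    simp
  rw [h, map_smul, zcoeff_mono]
  rcases Nat.eq_zero_or_pos s₂ with h0 | h0
  · subst h0; simp
  · have e : toZZ (x + s₁, y + (s₂ - 1)) = toZZ (s₁, s₂) + ((x : ℤ), (y : ℤ) - 1) := by
      simp only [toZZ_apply, Prod.mk_add_mk, Prod.mk.injEq]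
      omega
    simp [e]

lemma IsHomogDer.preserves {S : AddSubmonoid (ℕ × ℕ)}
    {D : Derivation k (MvPolynomial (Fin 2) k) (MvPolynomial (Fin 2) k)} {v : ℤ × ℤ}
    {φ : ℕ × ℕ → k} (hD : IsHomogDer D v φ)
    (h : ∀ s ∈ S, φ s ≠ 0 → v + toZZ s ∈ S.map toZZ) :
    ∀ f ∈ semigroupRing k S, D f ∈ semigroupRing k S := by
  intro f hf
  rw [eq_sum_mono f, map_sum]
  refine Subalgebra.sum_mem _ fun m hm => ?_
  rw [D.map_smul]
  refine Subalgebra.smul_mem _ ?_ _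
  rw [mem_semigroupRing]
  intro w hw
  rw [hD] at hw
  split_ifs at hw with e
  · rw [e, add_comm]; exact h _ (hf m hm) hw
  · exact absurd rfl hw

/-- The coefficient of `D (t^x u^y)` at the shift of `(x, y)` by `v` is linear in `(x, y)`. -/
lemma exists_linear_coeff [CharZero k] {S : AddSubmonoid (ℕ × ℕ)} {N : ℕ} (hN : N ≠ 0)
    (hT : (N, 0) ∈ S) (hU : (0, N) ∈ S)
    (D : Derivation k (semigroupRing k S) (semigroupRing k S)) :
    ∃ α β : ℤ × ℤ → k,
      (∀ (s : ℕ × ℕ) (hs : s ∈ S) (v : ℤ × ℤ),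
        zcoeff (toZZ s + v) (D ⟨mono k s, mono_mem hs⟩).1 = s.1 * α v + s.2 * β v) ∧
      ∃ F : Finset (ℤ × ℤ), ∀ v ∉ F, α v = 0 ∧ β v = 0 := by
  classical
  have hN' : (N : k) ≠ 0 := Nat.cast_ne_zero.mpr hN
  let c (v : ℤ × ℤ) (s : S) : k := zcoeff (toZZ s.1 + v) (D ⟨mono k s.1, mono_mem s.2⟩).1
  -- The Leibniz rule on a product of two monomials, read off in degree v.
  have hadd (v : ℤ × ℤ) (s s' : S) : c v (s + s') = c v s + c v s' := by
    have e : (⟨mono k (s + s').1, mono_mem (s + s').2⟩ : semigroupRing k S) =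
        ⟨mono k s.1, mono_mem s.2⟩ * ⟨mono k s'.1, mono_mem s'.2⟩ :=
      Subtype.ext (mono_add _ _)
    have e2 : (D ⟨mono k (s + s').1, mono_mem (s + s').2⟩).1 =
        mono k s.1 * (D ⟨mono k s'.1, mono_mem s'.2⟩).1 +
          mono k s'.1 * (D ⟨mono k s.1, mono_mem s.2⟩).1 := by
      rw [e, D.leibniz]; rfl
    change zcoeff _ _ = zcoeff _ _ + zcoeff _ _
    rw [e2, map_add, zcoeff_mono_mul, zcoeff_mono_mul, add_comm, AddSubmonoid.coe_add, map_add]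
    congr 3 <;> abel
  have hzero (v : ℤ × ℤ) : c v 0 = 0 := by
    have := hadd v 0 0
    rw [add_zero] at this
    exact left_eq_add.mp this
  let C (v : ℤ × ℤ) : S →+ k := { toFun := c v, map_zero' := hzero v, map_add' := hadd v }
  refine ⟨fun v => c v ⟨_, hT⟩ / N, fun v => c v ⟨_, hU⟩ / N, ?_, ?_⟩
  · intro s hs v
    have h1 : N • (⟨s, hs⟩ : S) = s.1 • ⟨_, hT⟩ + s.2 • ⟨_, hU⟩ := by
      apply Subtype.ext
      ext <;> simp [mul_comm]
    have h2 := congrArg (C v) h1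
    rw [map_add, map_nsmul, map_nsmul, map_nsmul] at h2
    simp only [nsmul_eq_mul] at h2
    change c v ⟨s, hs⟩ = _
    change (N : k) * c v _ = s.1 * c v _ + s.2 * c v _ at h2
    field_simp
    linear_combination h2
  -- Only the supports of D(t^N) and D(u^N) matter, so finitely many degrees occur.
  · have key (s : S) : ∃ F : Finset (ℤ × ℤ), ∀ v ∉ F, c v s = 0 := by
      refine ⟨(D ⟨mono k s.1, mono_mem s.2⟩).1.support.image
        (fun m => toZZ (m 0, m 1) - toZZ s.1), fun v hv => ?_⟩
      by_contra hne
      obtain ⟨q, hq⟩ := eq_toZZ_of_zcoeff_ne_zero hne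
      refine hv (Finset.mem_image.mpr ⟨expo q, ?_, ?_⟩)
      · rw [mem_support_iff, ← zcoeff_toZZ, ← hq]; exact hne
      · simp only [expo_zero_apply, expo_one_apply, Prod.mk.eta, ← hq]; abel
    obtain ⟨F, hF⟩ := key ⟨_, hT⟩
    obtain ⟨G, hG⟩ := key ⟨_, hU⟩
    refine ⟨F ∪ G, fun v hv => ?_⟩
    rw [Finset.mem_union, not_or] at hv
    exact ⟨by simp [hF v hv.1], by simp [hG v hv.2]⟩

/-- If no member of `Y` has a coefficient on `t^{s.1} u^{s.2}` at an exponent from which `w` is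
reached inside `S`, then the span of `Y` has none at `w`. -/
lemma zcoeff_span_eq_zero {S : AddSubmonoid (ℕ × ℕ)}
    {Y : Set (Derivation k (semigroupRing k S) (semigroupRing k S))}
    (s : semigroupRing k S) (w : ℤ × ℤ)
    (hY : ∀ E ∈ Y, ∀ q, zcoeff q (E s).1 ≠ 0 → w - q ∉ S.map toZZ)
    {E : Derivation k (semigroupRing k S) (semigroupRing k S)}
    (hE : E ∈ Submodule.span (semigroupRing k S) Y) : zcoeff w (E s).1 = 0 := by
  -- Vanishing at w alone is not stable under multiplication by ring elements; this stronger
  -- condition is, because such a multiplication shifts exponents by elements of S.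
  suffices h : ∀ q, zcoeff q (E s).1 ≠ 0 → w - q ∉ S.map toZZ by
    by_contra hne
    exact h w hne (by rw [sub_self]; exact zero_mem _)
  induction hE using Submodule.span_induction with
  | mem E hE => exact hY E hE
  | zero => intro q hq; simp at hq
  | add E E' _ _ h h' =>
    intro q hq
    have e : ((E + E') s).1 = (E s).1 + (E' s).1 := rfl
    rw [e, map_add] at hq
    by_cases h0 : zcoeff q (E s).1 = 0
    · exact h' q (by rwa [h0, zero_add] at hq)
    · exact h q h0
  | smul f E _ h =>
    intro q hq hmem
    have e : ((f • E) s).1 = f.1 * (E s).1 := rfl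
    rw [e] at hq
    obtain ⟨w₁, w₂, rfl, h1, h2⟩ := exists_zcoeff_of_mul hq
    refine h w₂ h2 ?_
    have := add_mem hmem (mem_semigroupRing.mp f.2 w₁ h1)
    convert this using 1
    abel

/-- A criterion for homogeneous derivations of a semigroup ring in two variables to minimally
generate the module of derivations, in terms of their degrees. -/
theorem minimallyGeneratesDer_of_degrees [CharZero k] {S : AddSubmonoid (ℕ × ℕ)} {N : ℕ}
    (hN : N ≠ 0) (hNT : (N, 0) ∈ S) (hNU : (0, N) ∈ S)
    (hCM : ∀ v : ℤ × ℤ, v + ((N : ℤ), 0) ∈ S.map toZZ → v + (0, (N : ℤ)) ∈ S.map toZZ → v ∈ S.map toZZ)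
    (T U : Set (ℕ × ℕ))
    (hT : ∀ x ∈ T, ∀ s ∈ S, s.1 ≠ 0 → toZZ x - (1, 0) + toZZ s ∈ S.map toZZ)
    (hU : ∀ x ∈ U, ∀ s ∈ S, s.2 ≠ 0 → toZZ x - (0, 1) + toZZ s ∈ S.map toZZ)
    (genT : ∀ v : ℤ × ℤ, (∀ s ∈ S, s.1 ≠ 0 → v + toZZ s ∈ S.map toZZ) →
      ∃ x ∈ T, v - (toZZ x - (1, 0)) ∈ S.map toZZ)
    (genU : ∀ v : ℤ × ℤ, (∀ s ∈ S, s.2 ≠ 0 → v + toZZ s ∈ S.map toZZ) →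
      ∃ x ∈ U, v - (toZZ x - (0, 1)) ∈ S.map toZZ)
    (minT : ∀ x ∈ T, ∀ y ∈ T, toZZ x - toZZ y ∈ S.map toZZ → x = y)
    (minU : ∀ x ∈ U, ∀ y ∈ U, toZZ x - toZZ y ∈ S.map toZZ → x = y) :
    MinimallyGeneratesDer (semigroupRing k S)
      ((fun x : ℕ × ℕ => derT k x.1 x.2) '' T ∪ (fun x : ℕ × ℕ => derU k x.1 x.2) '' U) := by
  classical
  have degT (x : ℕ × ℕ) : IsHomogDer (derT k x.1 x.2) (toZZ x - (1, 0)) (fun s => (s.1 : k)) := by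
    convert isHomogDer_derT (k := k) x.1 x.2 using 1
    simp [toZZ_apply]
  have degU (x : ℕ × ℕ) : IsHomogDer (derU k x.1 x.2) (toZZ x - (0, 1)) (fun s => (s.2 : k)) := by
    convert isHomogDer_derU (k := k) x.1 x.2 using 1
    simp [toZZ_apply]
  have presT : ∀ x ∈ T, ∀ f ∈ semigroupRing k S, derT k x.1 x.2 f ∈ semigroupRing k S :=
    fun x hx => (degT x).preserves fun s hs h => hT x hx s hs (by simpa using h)
  have presU : ∀ x ∈ U, ∀ f ∈ semigroupRing k S, derU k x.1 x.2 f ∈ semigroupRing k S :=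
    fun x hx => (degU x).preserves fun s hs h => hU x hx s hs (by simpa using h)
  refine ⟨?_, ?_, ?_⟩
  · rintro D (⟨x, hx, rfl⟩ | ⟨x, hx, rfl⟩)
    · exact presT x hx
    · exact presU x hx
  · rw [GeneratesDer, eq_top_iff]
    intro D _
    set Y := restrictions (semigroupRing k S)
      ((fun x : ℕ × ℕ => derT k x.1 x.2) '' T ∪ (fun x : ℕ × ℕ => derU k x.1 x.2) '' U)
    obtain ⟨α, β, hc, F, hF⟩ := exists_linear_coeff hN hNT hNU D
    have hmem (s : ℕ × ℕ) (hs : s ∈ S) (v : ℤ × ℤ) (h : (s.1 : k) * α v + s.2 * β v ≠ 0) :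
        v + toZZ s ∈ S.map toZZ := by
      rw [add_comm]
      rw [← hc s hs] at h
      exact mem_semigroupRing.mp (D _).2 _ h
    have h0T (v : ℤ × ℤ) (h : α v ≠ 0) : v + ((N : ℤ), 0) ∈ S.map toZZ := by
      have := hmem _ hNT v (by simpa [hN] using h)
      simpa [toZZ_apply] using this
    have h0U (v : ℤ × ℤ) (h : β v ≠ 0) : v + (0, (N : ℤ)) ∈ S.map toZZ := by
      have := hmem _ hNU v (by simpa [hN] using h)
      simpa [toZZ_apply] using this
    have condT (v : ℤ × ℤ) (h : α v ≠ 0) (s : ℕ × ℕ) (hs : s ∈ S) (hs0 : s.1 ≠ 0) :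
        v + toZZ s ∈ S.map toZZ := by
      by_cases hb : β v = 0
      · refine hmem s hs v ?_
        simpa [hb, hs0] using h
      -- With both coefficients nonzero, the mixed scalar could vanish at s; here `hCM` puts v
      -- itself in S.
      · exact add_mem (hCM v (h0T v h) (h0U v hb)) ⟨s, hs, rfl⟩
    have condU (v : ℤ × ℤ) (h : β v ≠ 0) (s : ℕ × ℕ) (hs : s ∈ S) (hs0 : s.2 ≠ 0) :
        v + toZZ s ∈ S.map toZZ := by
      by_cases ha : α v = 0
      · refine hmem s hs v ?_
        simpa [ha, hs0] using h
      · exact add_mem (hCM v (h0T v ha) (h0U v h)) ⟨s, hs, rfl⟩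
    have piece (A : Derivation k (MvPolynomial (Fin 2) k) (MvPolynomial (Fin 2) k))
        (φ : ℕ × ℕ → k) (u v : ℤ × ℤ) (hA : IsHomogDer A u φ)
        (hpres : ∀ f ∈ semigroupRing k S, A f ∈ semigroupRing k S)
        (hAY : A ∈ (fun x : ℕ × ℕ => derT k x.1 x.2) '' T ∪ (fun x : ℕ × ℕ => derU k x.1 x.2) '' U)
        (huv : v - u ∈ S.map toZZ) (a : k) :
        ∃ E ∈ Submodule.span (semigroupRing k S) Y, ∀ (s : ℕ × ℕ) (hs : s ∈ S) (w : ℤ × ℤ),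
          zcoeff w (E ⟨mono k s, mono_mem hs⟩).1 = if w = toZZ s + v then φ s * a else 0 := by
      obtain ⟨q, hq, hqv⟩ := huv
      refine ⟨(a • (⟨mono k q, mono_mem hq⟩ : semigroupRing k S)) • restrictDer _ A hpres,
        Submodule.smul_mem _ _ (Submodule.subset_span ⟨A, hAY, fun f => rfl⟩), ?_⟩
      intro s hs w
      change zcoeff w ((a • mono k q) * A (mono k s)) = _
      rw [smul_mul_assoc, map_smul, zcoeff_mono_mul, hA, hqv, smul_eq_mul]
      have : w - (v - u) = toZZ s + u ↔ w = toZZ s + v := by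
        constructor <;> intro h
        · rw [sub_eq_iff_eq_add] at h; rw [h]; abel
        · rw [h]; abel
      simp only [this]
      split_ifs <;> ring
    have zpiece (v : ℤ × ℤ) (φ : ℕ × ℕ → k) :
        ∃ E ∈ Submodule.span (semigroupRing k S) Y, ∀ (s : ℕ × ℕ) (hs : s ∈ S) (w : ℤ × ℤ),
          zcoeff w (E ⟨mono k s, mono_mem hs⟩).1 = if w = toZZ s + v then φ s * 0 else 0 :=
      ⟨0, zero_mem _, fun s hs w => by simp⟩
    have exE (v : ℤ × ℤ) : ∃ E ∈ Submodule.span (semigroupRing k S) Y,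
        ∀ (s : ℕ × ℕ) (hs : s ∈ S) (w : ℤ × ℤ), zcoeff w (E ⟨mono k s, mono_mem hs⟩).1 =
          if w = toZZ s + v then s.1 * α v + s.2 * β v else 0 := by
      obtain ⟨E₁, hE₁, h₁⟩ : ∃ E ∈ Submodule.span (semigroupRing k S) Y,
          ∀ (s : ℕ × ℕ) (hs : s ∈ S) (w : ℤ × ℤ), zcoeff w (E ⟨mono k s, mono_mem hs⟩).1 =
            if w = toZZ s + v then s.1 * α v else 0 := by
        by_cases h : α v = 0
        · rw [h]; exact zpiece v fun s => (s.1 : k)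
        · obtain ⟨x, hx, hxv⟩ := genT v (condT v h)
          exact piece _ _ _ v (degT x) (presT x hx) (Or.inl ⟨x, hx, rfl⟩) hxv _
      obtain ⟨E₂, hE₂, h₂⟩ : ∃ E ∈ Submodule.span (semigroupRing k S) Y,
          ∀ (s : ℕ × ℕ) (hs : s ∈ S) (w : ℤ × ℤ), zcoeff w (E ⟨mono k s, mono_mem hs⟩).1 =
            if w = toZZ s + v then s.2 * β v else 0 := by
        by_cases h : β v = 0
        · rw [h]; exact zpiece v fun s => (s.2 : k)
        · obtain ⟨x, hx, hxv⟩ := genU v (condU v h)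
          exact piece _ _ _ v (degU x) (presU x hx) (Or.inr ⟨x, hx, rfl⟩) hxv _
      refine ⟨E₁ + E₂, add_mem hE₁ hE₂, fun s hs w => ?_⟩
      change zcoeff w ((E₁ _).1 + (E₂ _).1) = _
      rw [map_add, h₁ s hs, h₂ s hs]
      split_ifs <;> simp
    choose E hE hEc using exE
    have hD : D = ∑ v ∈ F, E v := by
      have : (D : semigroupRing k S →ₗ[k] semigroupRing k S) =
          ((∑ v ∈ F, E v : Derivation k _ _) : semigroupRing k S →ₗ[k] semigroupRing k S) := by
        refine linearMap_ext_mono fun s hs => Subtype.ext (zcoeff_ext fun w => ?_)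
        have e1 : (((∑ v ∈ F, E v : Derivation k _ _)) ⟨mono k s, mono_mem hs⟩).1 =
            ∑ v ∈ F, (E v ⟨mono k s, mono_mem hs⟩).1 := by
          rw [show (∑ v ∈ F, E v : Derivation k _ _) ⟨mono k s, mono_mem hs⟩ =
              ∑ v ∈ F, E v ⟨mono k s, mono_mem hs⟩ from
                (congrFun (map_sum Derivation.coeFnAddMonoidHom E F) _).trans
                  (Finset.sum_apply _ _ _), AddSubmonoidClass.coe_finsetSum]
        change zcoeff w (D _).1 = zcoeff w ((∑ v ∈ F, E v : Derivation k _ _) _).1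
        rw [e1, map_sum]
        rw [Finset.sum_congr rfl fun v _ => hEc v s hs w]
        have e2 (v : ℤ × ℤ) : w = toZZ s + v ↔ w - toZZ s = v := by
          rw [sub_eq_iff_eq_add, add_comm]
        simp only [e2, Finset.sum_ite_eq]
        have := hc s hs (w - toZZ s)
        rw [add_sub_cancel] at this
        rw [this]
        split_ifs with h
        · rfl
        · simp [hF _ h]
      exact Derivation.ext fun f => LinearMap.congr_fun this f
    rw [hD]
    exact sum_mem fun v _ => hE v
  · intro Z hZ hgen
    obtain ⟨hsub, D, hDY, hDZ⟩ := Set.ssubset_iff_exists.mp hZ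
    have htop (E) : E ∈ Submodule.span (semigroupRing k S) (restrictions (semigroupRing k S) Z) := by
      rw [show Submodule.span (semigroupRing k S) _ = ⊤ from hgen]; trivial
    rcases hDY with ⟨x, hx, rfl⟩ | ⟨x, hx, rfl⟩
    -- The monomial t^N is killed by every ∂/∂u, so it isolates the generators in ∂/∂t; u^N does the
    -- converse below.
    · have hz := zcoeff_span_eq_zero ⟨mono k (N, 0), mono_mem hNT⟩
        (toZZ (N, 0) + (toZZ x - (1, 0))) ?_ (htop (restrictDer _ _ (presT x hx)))
      · rw [restrictDer_coe, degT x] at hz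
        simp [hN] at hz
      · rintro E ⟨D', hD', hED'⟩ q hq hmem
        rw [hED'] at hq
        rcases hsub hD' with ⟨y, hy, rfl⟩ | ⟨y, hy, rfl⟩
        · rw [degT y] at hq
          split_ifs at hq with e
          · have : toZZ x - toZZ y ∈ S.map toZZ := by
              convert hmem using 1; rw [e]; abel
            rw [minT x hx y hy this] at hDZ
            exact hDZ hD'
          · exact hq rfl
        · rw [degU y] at hq
          simp at hq
    · have hz := zcoeff_span_eq_zero ⟨mono k (0, N), mono_mem hNU⟩
        (toZZ (0, N) + (toZZ x - (0, 1))) ?_ (htop (restrictDer _ _ (presU x hx)))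
      · rw [restrictDer_coe, degU x] at hz
        simp [hN] at hz
      · rintro E ⟨D', hD', hED'⟩ q hq hmem
        rw [hED'] at hq
        rcases hsub hD' with ⟨y, hy, rfl⟩ | ⟨y, hy, rfl⟩
        · rw [degT y] at hq
          simp at hq
        · rw [degU y] at hq
          split_ifs at hq with e
          · have : toZZ x - toZZ y ∈ S.map toZZ := by
              convert hmem using 1; rw [e]; abel
            rw [minU x hx y hy this] at hDZ
            exact hDZ hD'
          · exact hq rfl

end

/-! ### Normal forms in the semigroup of an arithmetic sequence -/

section
variable {p d : ℕ} {n : ℕ → ℕ}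

/-- The numerical data of an arithmetic sequence with coprime terms. -/
structure IsCoprimeArith (p d : ℕ) (n : ℕ → ℕ) : Prop where
  hp : 0 < p
  hpos : 0 < n 0
  hn : ∀ i ≤ p, n i = n 0 + i * d
  hcop : IsCoprime (n p : ℤ) (d : ℤ)

namespace IsCoprimeArith

lemma cast_last (h : IsCoprimeArith p d n) : (n p : ℤ) = n 0 + p * d := by
  exact_mod_cast h.hn p le_rfl

lemma lt_last (hd : 0 < d) (h : IsCoprimeArith p d n) : p < n p := by
  have := h.hn p le_rfl
  have := h.hpos
  nlinarith

lemma gen_mem (h : IsCoprimeArith p d n) {e : ℕ} (he : e ≤ p) :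
    (n p - e * d, e * d) ∈ projSemigroup p n := by
  apply AddSubmonoid.subset_closure
  rcases Nat.eq_zero_or_pos e with rfl | h0
  · left; right; simp
  · right
    refine ⟨p - e, by omega, ?_⟩
    rw [h.hn p le_rfl, h.hn (p - e) (by omega)]
    obtain ⟨f, rfl⟩ := Nat.exists_eq_add_of_le he
    simp only [Nat.add_sub_cancel_left, add_mul]
    ext
    all_goals simp only; omega

/-- Any g ≤ jp is a sum of j numbers e ≤ p, and each e contributes one generator (n_p - ed, ed). -/
lemma sum_mem (h : IsCoprimeArith p d n) (j : ℕ) : ∀ g ≤ j * p,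
    (j * n p - g * d, g * d) ∈ projSemigroup p n := by
  have hle (e j : ℕ) (he : e ≤ j * p) : e * d ≤ j * n p := by
    calc e * d ≤ j * p * d := Nat.mul_le_mul_right _ he
      _ = j * (p * d) := by ring
      _ ≤ j * n p := Nat.mul_le_mul_left _ (by rw [h.hn p le_rfl]; omega)
  induction j with
  | zero =>
    intro g hg
    obtain rfl : g = 0 := by omega
    rw [zero_mul, zero_mul, Nat.zero_sub]
    exact zero_mem _
  | succ j ih =>
    intro g hg
    obtain ⟨e, f, he, hf, rfl⟩ : ∃ e f, e ≤ p ∧ f ≤ j * p ∧ g = e + f :=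
      ⟨min g p, g - min g p, by omega, by rw [add_mul] at hg; omega, by omega⟩
    convert add_mem (h.gen_mem he) (ih f hf) using 1
    have h1 := hle e 1 (by omega)
    have h2 := hle f j hf
    ext
    · simp only [Prod.mk_add_mk, add_mul, one_mul] at *
      omega
    · simp only [Prod.mk_add_mk, add_mul]

/-- The semigroup in terms of normal forms `x = j n_p - g d` with `0 ≤ g < n_p`. -/
lemma mem_iff (hd : 0 < d) (h : IsCoprimeArith p d n) {w : ℤ × ℤ} :
    w ∈ (projSemigroup p n).map toZZ ↔ ∃ j g m : ℤ, 0 ≤ g ∧ g < n p ∧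
      w.1 = j * n p - g * d ∧ w.1 + w.2 = m * n p ∧ g ≤ j * p ∧ j ≤ m := by
  have hN := h.cast_last
  have hlt : (p : ℤ) < n p := by exact_mod_cast h.lt_last hd
  have hp0 : (0 : ℤ) < p := by exact_mod_cast h.hp
  constructor
  · rintro ⟨s, hs, rfl⟩
    simp only [toZZ_apply]
    induction hs using AddSubmonoid.closure_induction with
    | mem s hs =>
      rcases hs with (rfl | rfl) | ⟨i, hi, rfl⟩
      · exact ⟨0, 0, 1, by simp; omega⟩
      · exact ⟨1, 0, 1, by simp; omega⟩
      · have hi' := h.hn i hi.le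
        have hle : n i ≤ n p := by
          rw [hi', h.hn p le_rfl]
          exact Nat.add_le_add_left (Nat.mul_le_mul_right _ hi.le) _
        refine ⟨1, p - i, 1, by omega, by omega, ?_, ?_, by omega, le_rfl⟩
        · simp only; rw [hN, hi']; push_cast; ring
        · simp only; push_cast [hle]; ring
    | zero => exact ⟨0, 0, 0, by simp; omega⟩
    | add s s' _ _ ih ih' =>
      obtain ⟨j, g, m, h1, h2, h3, h4, h5, h6⟩ := ih
      obtain ⟨j', g', m', h1', h2', h3', h4', h5', h6'⟩ := ih'
      simp only [Prod.fst_add, Prod.snd_add, Nat.cast_add]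
      by_cases hg : g + g' < n p
      · exact ⟨j + j', g + g', m + m', by omega, hg, by rw [h3, h3']; ring,
          by linear_combination h4 + h4', by linarith, by omega⟩
      -- Wrapping around: lowering g by n_p lowers j by d. The bound g ≤ jp survives because n_p ≥
      -- pd.
      · refine ⟨j + j' - d, g + g' - n p, m + m', by omega, by omega, by rw [h3, h3']; ring,
          by linear_combination h4 + h4', ?_, by omega⟩
        rw [hN]; nlinarith [h.hpos]
  · rintro ⟨j, g, m, h1, -, h3, h4, h5, h6⟩
    have hj : 0 ≤ j := by
      by_contra hneg
      nlinarith
    lift j to ℕ using hj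
    lift g to ℕ using h1
    obtain ⟨c, rfl⟩ : ∃ c : ℕ, m = j + c := ⟨(m - j).toNat, by omega⟩
    have hg : g ≤ j * p := by exact_mod_cast h5
    have hle : g * d ≤ j * n p := by
      calc g * d ≤ j * p * d := Nat.mul_le_mul_right _ hg
        _ = j * (p * d) := by ring
        _ ≤ j * n p := Nat.mul_le_mul_left _ (by rw [h.hn p le_rfl]; omega)
    have hc : (0, n p) ∈ projSemigroup p n := AddSubmonoid.subset_closure (by simp)
    refine ⟨_, add_mem (h.sum_mem j g hg) (AddSubmonoid.nsmul_mem _ hc c), ?_⟩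
    rw [toZZ_apply]
    ext
    · simp [Nat.cast_sub hle, h3]
    · simp
      linear_combination h3 - h4

lemma normalForm_unique (h : IsCoprimeArith p d n) {j g j' g' : ℤ} (hg : 0 ≤ g) (hg1 : g < n p)
    (hg' : 0 ≤ g') (hg1' : g' < n p) (e : j * n p - g * d = j' * n p - g' * d) :
    j = j' ∧ g = g' := by
  have hdvd : (n p : ℤ) ∣ (g - g') * d := ⟨j - j', by linear_combination -e⟩
  have h0 : g - g' = 0 :=
    Int.eq_zero_of_abs_lt_dvd (h.hcop.dvd_of_dvd_mul_right hdvd) (by rw [abs_lt]; omega)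
  have hgg : g = g' := by omega
  refine ⟨?_, hgg⟩
  subst hgg
  have hne : (n p : ℤ) ≠ 0 := by omega
  exact mul_right_cancel₀ hne (by linarith)

lemma mem_iff_of_lt (hd : 0 < d) (h : IsCoprimeArith p d n) {w : ℤ × ℤ} {j g m : ℤ}
    (hw : w.1 = j * n p - g * d) (hw2 : w.1 + w.2 = m * n p) (h0 : 0 ≤ g) (h1 : g < n p) :
    w ∈ (projSemigroup p n).map toZZ ↔ g ≤ j * p ∧ j ≤ m := by
  rw [h.mem_iff hd]
  constructor
  · rintro ⟨j', g', m', h0', h1', e, e2, h5, h6⟩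
    obtain ⟨rfl, rfl⟩ := h.normalForm_unique h0 h1 h0' h1' (hw.symm.trans e)
    have hne : (n p : ℤ) ≠ 0 := by omega
    obtain rfl : m = m' := mul_right_cancel₀ hne (hw2.symm.trans e2)
    exact ⟨h5, h6⟩
  · rintro ⟨h5, h6⟩
    exact ⟨j, g, m, h0, h1, hw, hw2, h5, h6⟩

/-- After one wrap, (j, g) becomes (j - d, g - n_p); the slack n_0 is n_p - pd. -/
lemma mem_iff_of_le (hd : 0 < d) (h : IsCoprimeArith p d n) {w : ℤ × ℤ} {j g m : ℤ}
    (hw : w.1 = j * n p - g * d) (hw2 : w.1 + w.2 = m * n p) (h0 : n p ≤ g) (h1 : g < 2 * n p) :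
    w ∈ (projSemigroup p n).map toZZ ↔ g ≤ j * p + n 0 ∧ j ≤ m + d := by
  rw [h.mem_iff_of_lt hd (j := j - d) (g := g - n p) (m := m) (by rw [hw]; ring) hw2
    (by omega) (by omega), h.cast_last]
  constructor <;> rintro ⟨h2, h3⟩ <;> exact ⟨by linarith, by omega⟩

/-- The criterion for a degree `v` to map the nonunit elements of the semigroup off the
second axis into the semigroup. -/
lemma forall_fst_iff (h : IsCoprimeArith p d n) (v : ℤ × ℤ) :
    (∀ s ∈ projSemigroup p n, s.1 ≠ 0 → v + toZZ s ∈ (projSemigroup p n).map toZZ) ↔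
      ∀ e : ℤ, 0 ≤ e → e ≤ p → v + (n p - e * d, e * d) ∈ (projSemigroup p n).map toZZ := by
  have hN := h.cast_last
  have hp := h.hpos
  constructor
  · intro H e h0 h1
    lift e to ℕ using h0
    have h1' : e ≤ p := by exact_mod_cast h1
    have hle : e * d < n p := by
      have := Nat.mul_le_mul_right d h1'
      rw [h.hn p le_rfl]; omega
    have := H _ (h.gen_mem h1') (by simp only; omega)
    simpa [toZZ_apply, Nat.cast_sub hle.le] using this
  · intro H s hs
    induction hs using AddSubmonoid.closure_induction with
    | mem s hs =>
      intro hs0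
      rcases hs with (rfl | rfl) | ⟨i, hi, rfl⟩
      · simp at hs0
      · simpa [toZZ_apply] using H 0 le_rfl (by omega)
      · have hi' := h.hn i hi.le
        have hle : n i ≤ n p := by
          rw [hi', h.hn p le_rfl]
          exact Nat.add_le_add_left (Nat.mul_le_mul_right _ hi.le) _
        convert H (p - i) (by omega) (by omega) using 3
        · change (n i : ℤ) = _
          rw [hN, hi']; push_cast; ring
        · change ((n p - n i : ℕ) : ℤ) = _
          rw [Nat.cast_sub hle, hN, hi']; push_cast; ring
    | zero => simp
    | add s s' hs hs' ih ih' =>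
      intro hne
      rw [map_add]
      by_cases h0 : s.1 = 0
      · rw [add_comm (toZZ s), ← add_assoc]
        exact add_mem (ih' (by simpa [h0] using hne)) ⟨s, hs, rfl⟩
      · rw [← add_assoc]
        exact add_mem (ih h0) ⟨s', hs', rfl⟩

/-- The criterion for a degree `v` to map the nonunit elements of the semigroup off the
first axis into the semigroup. -/
lemma forall_snd_iff (hd : 0 < d) (h : IsCoprimeArith p d n) (v : ℤ × ℤ) :
    (∀ s ∈ projSemigroup p n, s.2 ≠ 0 → v + toZZ s ∈ (projSemigroup p n).map toZZ) ↔
      v + (0, (n p : ℤ)) ∈ (projSemigroup p n).map toZZ ∧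
      ∀ e : ℤ, 1 ≤ e → e ≤ p → v + (n p - e * d, e * d) ∈ (projSemigroup p n).map toZZ := by
  have hN := h.cast_last
  have hp := h.hpos
  constructor
  · intro H
    refine ⟨?_, fun e h0 h1 => ?_⟩
    · have := H (0, n p) (AddSubmonoid.subset_closure (by simp))
        (by have := h.lt_last hd; simp only; omega)
      simpa [toZZ_apply] using this
    · lift e to ℕ using (by omega)
      have h1' : e ≤ p := by exact_mod_cast h1
      have hle : e * d < n p := by
        have := Nat.mul_le_mul_right d h1'
        rw [h.hn p le_rfl]; omega
      have he : 0 < e * d := Nat.mul_pos (by omega) hd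
      have := H _ (h.gen_mem h1') (by simp only; omega)
      simpa [toZZ_apply, Nat.cast_sub hle.le] using this
  · rintro ⟨H0, H⟩ s hs
    induction hs using AddSubmonoid.closure_induction with
    | mem s hs =>
      intro hs0
      rcases hs with (rfl | rfl) | ⟨i, hi, rfl⟩
      · simpa [toZZ_apply] using H0
      · simp at hs0
      · have hi' := h.hn i hi.le
        have hle : n i ≤ n p := by
          rw [hi', h.hn p le_rfl]
          exact Nat.add_le_add_left (Nat.mul_le_mul_right _ hi.le) _
        convert H (p - i) (by omega) (by omega) using 3
        · change (n i : ℤ) = _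
          rw [hN, hi']; push_cast; ring
        · change ((n p - n i : ℕ) : ℤ) = _
          rw [Nat.cast_sub hle, hN, hi']; push_cast; ring
    | zero => simp
    | add s s' hs hs' ih ih' =>
      intro hne
      rw [map_add]
      by_cases h0 : s.2 = 0
      · rw [add_comm (toZZ s), ← add_assoc]
        exact add_mem (ih' (by simpa [h0] using hne)) ⟨s, hs, rfl⟩
      · rw [← add_assoc]
        exact add_mem (ih h0) ⟨s', hs', rfl⟩

/-- Adding (n_p, 0) raises j and m together, so it tests j ≤ m for v; adding (0, n_p) keeps j and g,
so it tests g ≤ jp. -/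
lemma mem_of_add_mem (hd : 0 < d) (h : IsCoprimeArith p d n) (v : ℤ × ℤ)
    (h1 : v + ((n p : ℤ), 0) ∈ (projSemigroup p n).map toZZ)
    (h2 : v + (0, (n p : ℤ)) ∈ (projSemigroup p n).map toZZ) :
    v ∈ (projSemigroup p n).map toZZ := by
  obtain ⟨j, g, m, h0, hlt, e1, e2, h5, h6⟩ := (h.mem_iff hd).mp h1
  simp only [Prod.fst_add, Prod.snd_add] at e1 e2
  rw [h.mem_iff_of_lt hd (j := j - 1) (g := g) (m := m) (by simp; linarith)
    (by simp; linarith) h0 hlt] at h2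
  rw [h.mem_iff_of_lt hd (j := j - 1) (g := g) (m := m - 1) (by linarith) (by linarith) h0 hlt]
  exact ⟨h2.1, by omega⟩

/-- The degrees outside the semigroup that map every generator except `(0, n_p)` into it. -/
lemma forall_fst_iff_of_normalForm (hd : 0 < d) (h : IsCoprimeArith p d n) (hp0 : p ≤ n 0)
    {v : ℤ × ℤ} {j g m : ℤ}
    (hw : v.1 = j * n p - g * d) (hw2 : v.1 + v.2 = m * n p) (h0 : 0 ≤ g) (h1 : g < n p)
    (hv : v ∉ (projSemigroup p n).map toZZ) :
    (∀ s ∈ projSemigroup p n, s.1 ≠ 0 → v + toZZ s ∈ (projSemigroup p n).map toZZ) ↔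
      j * p < g ∧ g ≤ (j + 1) * p ∧ n p - p ≤ g ∧ n p - 1 ≤ (j + 1) * p ∧ j ≤ m := by
  have hN := h.cast_last
  have hlt := h.lt_last hd
  rw [h.mem_iff_of_lt hd hw hw2 h0 h1] at hv
  rw [h.forall_fst_iff]
  have A (e : ℤ) (he : 0 ≤ e) (hg : g + e < n p) :
      v + (n p - e * d, e * d) ∈ (projSemigroup p n).map toZZ ↔
        g + e ≤ (j + 1) * p ∧ j + 1 ≤ m + 1 :=
    h.mem_iff_of_lt hd (by simp only [Prod.fst_add]; rw [hw]; ring)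
      (by simp only [Prod.fst_add, Prod.snd_add]; linear_combination hw2) (by omega) hg
  have B (e : ℤ) (he : e ≤ p) (hg : n p ≤ g + e) :
      v + (n p - e * d, e * d) ∈ (projSemigroup p n).map toZZ ↔
        g + e ≤ (j + 1) * p + n 0 ∧ j + 1 ≤ m + 1 + d :=
    h.mem_iff_of_le hd (by simp only [Prod.fst_add]; rw [hw]; ring)
      (by simp only [Prod.fst_add, Prod.snd_add]; linear_combination hw2) hg (by omega)
  constructor
  · intro H
    have H0 := (A 0 le_rfl (by omega)).mp (H 0 le_rfl (by omega))
    have hjm : j ≤ m := by omega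
    have hjg : j * p < g := by
      by_contra hc
      exact hv ⟨by omega, hjm⟩
    have hgp : n p - p ≤ g := by
      by_contra hc
      have := (A p (by omega) (by omega)).mp (H p (by omega) le_rfl)
      rw [add_mul] at this
      omega
    -- The largest e for which g + e does not wrap gives the sharpest bound.
    have H1 := (A (n p - 1 - g) (by omega) (by omega)).mp (H (n p - 1 - g) (by omega) (by omega))
    exact ⟨hjg, by omega, hgp, by omega, hjm⟩
  · rintro ⟨h2, h3, h4, h5, h6⟩ e he he'
    by_cases hg : g + e < n p
    · exact (A e he hg).mpr ⟨by omega, by omega⟩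
    · exact (B e he' (by omega)).mpr ⟨by omega, by omega⟩

/-- The degrees outside the semigroup that map every generator except `(n_p, 0)` into it. -/
lemma forall_snd_iff_of_normalForm (hd : 0 < d) (h : IsCoprimeArith p d n)
    {v : ℤ × ℤ} {j g m : ℤ}
    (hw : v.1 = j * n p - g * d) (hw2 : v.1 + v.2 = m * n p) (h0 : 0 ≤ g) (h1 : g < n p)
    (hv : v ∉ (projSemigroup p n).map toZZ) :
    (∀ s ∈ projSemigroup p n, s.2 ≠ 0 → v + toZZ s ∈ (projSemigroup p n).map toZZ) ↔
      g = n p - 1 ∧ j = m + 1 ∧ n p - 1 ≤ j * p := by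
  have hN := h.cast_last
  have hlt := h.lt_last hd
  have hp := h.hp
  have hpos := h.hpos
  rw [h.mem_iff_of_lt hd hw hw2 h0 h1] at hv
  rw [h.forall_snd_iff hd]
  have A (e : ℤ) (he : 0 ≤ e) (hg : g + e < n p) :
      v + (n p - e * d, e * d) ∈ (projSemigroup p n).map toZZ ↔
        g + e ≤ (j + 1) * p ∧ j + 1 ≤ m + 1 :=
    h.mem_iff_of_lt hd (by simp only [Prod.fst_add]; rw [hw]; ring)
      (by simp only [Prod.fst_add, Prod.snd_add]; linear_combination hw2) (by omega) hg
  have B (e : ℤ) (he : e ≤ p) (hg : n p ≤ g + e) :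
      v + (n p - e * d, e * d) ∈ (projSemigroup p n).map toZZ ↔
        g + e ≤ (j + 1) * p + n 0 ∧ j + 1 ≤ m + 1 + d :=
    h.mem_iff_of_le hd (by simp only [Prod.fst_add]; rw [hw]; ring)
      (by simp only [Prod.fst_add, Prod.snd_add]; linear_combination hw2) hg (by omega)
  have C : v + (0, (n p : ℤ)) ∈ (projSemigroup p n).map toZZ ↔ g ≤ j * p ∧ j ≤ m + 1 :=
    h.mem_iff_of_lt hd (by simp only [Prod.fst_add]; rw [hw]; ring)
      (by simp only [Prod.fst_add, Prod.snd_add]; linear_combination hw2) h0 h1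
  constructor
  · rintro ⟨H0, H⟩
    rw [C] at H0
    have hj : j = m + 1 := by
      by_contra hc
      exact hv ⟨H0.1, by omega⟩
    have hg : g = n p - 1 := by
      by_contra hc
      -- If g < n_p - 1, the generator with e = 1 does not wrap and would force j ≤ m.
      have := (A 1 (by omega) (by omega)).mp (H 1 le_rfl (by omega))
      omega
    exact ⟨hg, hj, by omega⟩
  · rintro ⟨rfl, rfl, h2⟩
    refine ⟨C.mpr ⟨h2, le_rfl⟩, fun e he he' => (B e he' (by omega)).mpr ⟨?_, by omega⟩⟩
    rw [add_mul (m + 1)]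
    omega

end IsCoprimeArith
end

/-! ### The explicit generators -/

section
variable {p d : ℕ} {n : ℕ → ℕ}

lemma triple_union_setOf_eq {α ι : Type*} (u v t : α) (f : ι → α) (I : Set ι) :
    {u, v, t} ∪ {D | ∃ i ∈ I, D = f i} = {t} ∪ f '' I ∪ {u, v} := by
  have hf : {D | ∃ i ∈ I, D = f i} = f '' I := Set.ext fun D =>
    ⟨fun ⟨i, hi, e⟩ => ⟨i, hi, e.symm⟩, fun ⟨i, hi, e⟩ => ⟨i, hi, e.symm⟩⟩
  rw [hf]
  ext D
  simp only [Set.mem_union, Set.mem_insert_iff, Set.mem_singleton_iff]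
  tauto

/-- An element of the semigroup of nonpositive total degree vanishes. -/
lemma eq_of_sub_mem {S : AddSubmonoid (ℕ × ℕ)} {x y : ℕ × ℕ}
    (h : toZZ x - toZZ y ∈ S.map toZZ) (hle : (x.1 : ℤ) + x.2 ≤ y.1 + y.2) : x = y := by
  obtain ⟨s, -, hs⟩ := h
  have h1 := congrArg Prod.fst hs
  have h2 := congrArg Prod.snd hs
  simp only [toZZ_apply, Prod.fst_sub, Prod.snd_sub] at h1 h2
  ext <;> omega

/-- The minimal generators of the module of derivations in terms of the integer `J` with
`J p < n_p - 1 ≤ (J + 1) p`. -/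
theorem IsCoprimeArith.minimallyGeneratesDer (k : Type*) [Field k] [CharZero k] (hd : 0 < d)
    (h : IsCoprimeArith p d n) (hp0 : p ≤ n 0) {J : ℕ} (hJ : J * p + 1 < n p)
    (hJ' : n p ≤ (J + 1) * p + 1) (I : Set ℕ)
    (hI : ∀ i, i ∈ I ↔ 1 ≤ i ∧ i ≤ p ∧ J * p + i < n p ∧ n p ≤ (J + 1) * p + i)
    (x y : ℕ → ℕ) (hx : ∀ i ∈ I, (x i : ℤ) = J * n p - (n p - i) * d + 1)
    (hy : ∀ i ∈ I, (y i : ℤ) = (n p - i) * d)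
    (ux uy : ℕ) (hux : (ux : ℤ) = (J + 1) * n p - (n p - 1) * d)
    (huy : (uy : ℤ) = (n p - 1) * d - n p + 1) :
    MinimallyGeneratesDer (semigroupRing k (projSemigroup p n))
      ({derU k 0 1, derU k ux uy, derT k 1 0} ∪ {D | ∃ i ∈ I, D = derT k (x i) (y i)}) := by
  have hlt := h.lt_last hd
  have hp := h.hp
  have hpZ : (0 : ℤ) < p := by exact_mod_cast hp
  have hJZ : (J : ℤ) * p + 1 < n p := by exact_mod_cast hJ
  have hJZ' : (n p : ℤ) ≤ (J + 1) * p + 1 := by exact_mod_cast hJ'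
  set S := projSemigroup p n with hS
  have notMemT : ∀ i ∈ I, toZZ (x i, y i) - (1, 0) ∉ S.map toZZ := by
    intro i hi
    obtain ⟨h1, h2, h3, h4⟩ := (hI i).mp hi
    have h3' : (J : ℤ) * p + i < n p := by exact_mod_cast h3
    rw [h.mem_iff_of_lt hd (j := J) (g := n p - i) (m := J)
      (by simp only [toZZ_apply, Prod.fst_sub]; rw [hx i hi]; ring)
      (by simp only [toZZ_apply, Prod.fst_sub, Prod.snd_sub]; rw [hx i hi, hy i hi]; ring)
      (by omega) (by omega)]
    omega
  have notMemU : toZZ (ux, uy) - (0, 1) ∉ S.map toZZ := by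
    rw [h.mem_iff_of_lt hd (j := J + 1) (g := n p - 1) (m := J)
      (by simp only [toZZ_apply, Prod.fst_sub]; rw [hux]; ring)
      (by simp only [toZZ_apply, Prod.fst_sub, Prod.snd_sub]; rw [hux, huy]; ring)
      (by omega) (by omega)]
    omega
  have main := minimallyGeneratesDer_of_degrees (k := k) (S := S) (N := n p) (by omega)
    (AddSubmonoid.subset_closure (by simp)) (AddSubmonoid.subset_closure (by simp))
    (h.mem_of_add_mem hd) ({(1, 0)} ∪ (fun i => (x i, y i)) '' I) {(0, 1), (ux, uy)}
    ?_ ?_ ?_ ?_ ?_ ?_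
  · convert main using 1
    rw [Set.image_union, Set.image_singleton, Set.image_image, Set.image_pair,
      triple_union_setOf_eq]
  · rintro _ (rfl | ⟨i, hi, rfl⟩)
    · intro s hs _
      simpa [toZZ_apply] using (⟨s, hs, rfl⟩ : toZZ s ∈ S.map toZZ)
    · obtain ⟨h1, h2, h3, h4⟩ := (hI i).mp hi
      have h3' : (J : ℤ) * p + i < n p := by exact_mod_cast h3
      have h4' : (n p : ℤ) ≤ (J + 1) * p + i := by exact_mod_cast h4
      rw [h.forall_fst_iff_of_normalForm hd hp0 (j := J) (g := n p - i) (m := J)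
        (by simp only [toZZ_apply, Prod.fst_sub]; rw [hx i hi]; ring)
        (by simp only [toZZ_apply, Prod.fst_sub, Prod.snd_sub]; rw [hx i hi, hy i hi]; ring)
        (by omega) (by omega) (notMemT i hi)]
      exact ⟨by omega, by omega, by omega, by omega, le_rfl⟩
  · rintro _ (rfl | rfl)
    · intro s hs _
      simpa [toZZ_apply] using (⟨s, hs, rfl⟩ : toZZ s ∈ S.map toZZ)
    · rw [h.forall_snd_iff_of_normalForm hd (j := J + 1) (g := n p - 1) (m := J)
        (by simp only [toZZ_apply, Prod.fst_sub]; rw [hux]; ring)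
        (by simp only [toZZ_apply, Prod.fst_sub, Prod.snd_sub]; rw [hux, huy]; ring)
        (by omega) (by omega) notMemU]
      exact ⟨rfl, rfl, by omega⟩
  · intro v hv
    by_cases hvS : v ∈ S.map toZZ
    · exact ⟨(1, 0), Or.inl rfl, by simpa [toZZ_apply] using hvS⟩
    have h0 := (h.forall_fst_iff v).mp hv 0 le_rfl hpZ.le
    obtain ⟨j, g, m, hg0, hg1, e1, e2, -, -⟩ := (h.mem_iff hd).mp h0
    simp only [Prod.fst_add, Prod.snd_add] at e1 e2
    have e1' : v.1 = (j - 1) * n p - g * d := by linear_combination e1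
    have e2' : v.1 + v.2 = (m - 1) * n p := by linear_combination e2
    obtain ⟨c1, c2, c3, c4, c5⟩ :=
      (h.forall_fst_iff_of_normalForm hd hp0 e1' e2' hg0 hg1 hvS).mp hv
    -- Here j belongs to v + (n_p, 0), so v has j - 1. It is J, since (j - 1)p < g ≤ n_p - 1 ≤ jp.
    obtain rfl : j = J + 1 := by
      have : j - 1 < J + 1 := lt_of_mul_lt_mul_right (a := (p : ℤ)) (by omega) hpZ.le
      have : (J : ℤ) < j - 1 + 1 := lt_of_mul_lt_mul_right (a := (p : ℤ)) (by omega) hpZ.le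
      omega
    rw [add_sub_cancel_right] at c1 c2 e1'
    obtain ⟨i, hgi⟩ : ∃ i : ℕ, g = n p - i := ⟨(n p - g).toNat, by omega⟩
    have hi : i ∈ I := by
      rw [hI]
      refine ⟨by omega, by omega, ?_, ?_⟩
      · zify; omega
      · zify; omega
    refine ⟨(x i, y i), Or.inr ⟨i, hi, rfl⟩, ?_⟩
    -- The difference of degrees is m - 1 - J copies of (0, n_p).
    rw [h.mem_iff_of_lt hd (j := 0) (g := 0) (m := m - 1 - J) ?_ ?_ le_rfl (by omega)]
    · exact ⟨by omega, by omega⟩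
    · simp only [toZZ_apply, Prod.fst_sub]
      rw [hx i hi, e1', hgi]; ring
    · simp only [toZZ_apply, Prod.fst_sub, Prod.snd_sub]
      rw [hx i hi, hy i hi]
      linear_combination e2'
  · intro v hv
    by_cases hvS : v ∈ S.map toZZ
    · exact ⟨(0, 1), Or.inl rfl, by simpa [toZZ_apply] using hvS⟩
    have h0 := ((h.forall_snd_iff hd v).mp hv).1
    obtain ⟨j, g, m, hg0, hg1, e1, e2, -, -⟩ := (h.mem_iff hd).mp h0
    simp only [Prod.fst_add, Prod.snd_add] at e1 e2
    have e1' : v.1 = j * n p - g * d := by linear_combination e1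
    have e2' : v.1 + v.2 = (m - 1) * n p := by linear_combination e2
    obtain ⟨rfl, rfl, c3⟩ :=
      (h.forall_snd_iff_of_normalForm hd e1' e2' hg0 hg1 hvS).mp hv
    have hJj : (J : ℤ) < m - 1 + 1 := lt_of_mul_lt_mul_right (a := (p : ℤ)) (by omega) hpZ.le
    refine ⟨(ux, uy), Or.inr rfl, ?_⟩
    -- The difference of degrees is m - 1 - J copies of (n_p, 0).
    rw [h.mem_iff_of_lt hd (j := m - 1 - J) (g := 0) (m := m - 1 - J) ?_ ?_ le_rfl (by omega)]
    · exact ⟨mul_nonneg (by omega) hpZ.le, le_rfl⟩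
    · simp only [toZZ_apply, Prod.fst_sub]
      rw [hux, e1']; ring
    · simp only [toZZ_apply, Prod.fst_sub, Prod.snd_sub]
      rw [hux, huy]
      linear_combination e2'
  · rintro _ (rfl | ⟨i, hi, rfl⟩) _ (rfl | ⟨i', hi', rfl⟩) hmem
    · rfl
    · refine eq_of_sub_mem hmem ?_
      simp only [hx i' hi', hy i' hi']
      have : (0 : ℤ) ≤ J * n p := by positivity
      push_cast
      linarith
    · exact absurd (by simpa [toZZ_apply] using hmem) (notMemT i hi)
    -- All these exponents have the same total degree J n_p + 1, so none is reached from another.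
    · refine eq_of_sub_mem hmem (le_of_eq ?_)
      simp only [hx i hi, hy i hi, hx i' hi', hy i' hi']
      ring
  · rintro _ (rfl | rfl) _ (rfl | rfl) hmem
    · rfl
    · refine eq_of_sub_mem hmem ?_
      simp only [hux, huy]
      have : (0 : ℤ) ≤ J * n p := by positivity
      push_cast
      linarith
    · exact absurd (by simpa [toZZ_apply] using hmem) notMemU
    · rfl

/-- A common divisor of n_p and d divides n_0, hence every term. -/
lemma isCoprimeArith_of_gcd (hp : 0 < p) (hpos : 0 < n 0)
    (hn : ∀ i ∈ Set.Icc 1 p, n i = n 0 + i * d) (hgcd : (Finset.range (p + 1)).gcd n = 1) :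
    IsCoprimeArith p d n := by
  have hn' : ∀ i ≤ p, n i = n 0 + i * d := by
    intro i hi
    rcases Nat.eq_zero_or_pos i with rfl | h0
    · simp
    · exact hn i ⟨h0, hi⟩
  refine ⟨hp, hpos, hn', ?_⟩
  rw [Nat.isCoprime_iff_coprime, Nat.coprime_iff_gcd_eq_one, ← Nat.dvd_one, ← hgcd]
  refine Finset.dvd_gcd fun i hi => ?_
  have hc1 := Nat.gcd_dvd_left (n p) d
  have hc2 := Nat.gcd_dvd_right (n p) d
  rw [hn' i (by simpa [Nat.lt_succ_iff] using hi)]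
  refine dvd_add ?_ (hc2.mul_left i)
  rw [hn' p le_rfl] at hc1 ⊢
  exact (Nat.dvd_add_left ((Nat.gcd_dvd_right _ d).mul_left p)).mp hc1

/-- In a minimal arithmetic sequence the first term is at least the number of steps. -/
lemma le_of_isMinimalSeq (hpos : 0 < n 0) (hn : ∀ i ∈ Set.Icc 1 p, n i = n 0 + i * d)
    (hmin : IsMinimalSeq p n) : p < n 0 := by
  by_contra hlt
  -- If n_0 ≤ p, the term of index n_0 exists and equals (d + 1) n_0.
  refine hmin (n 0) (by omega) ?_
  rw [hn (n 0) ⟨hpos, by omega⟩, show n 0 + n 0 * d = (d + 1) • n 0 by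
    rw [smul_eq_mul]; ring]
  refine AddSubmonoid.nsmul_mem _ (AddSubmonoid.subset_closure ?_) _
  exact ⟨0, by omega, by omega, rfl⟩

end

theorem theorem4p5 (k : Type*) [Field k] [CharZero k]
    (p d a b : ℕ) (n : ℕ → ℕ)
    (hp : 2 ≤ p) (hd : 0 < d)
    (hpos : 0 < n 0)
    (hn : ∀ i ∈ Set.Icc 1 p, n i = n 0 + i * d)
    (hgcd : (Finset.range (p + 1)).gcd n = 1)
    (hmin : IsMinimalSeq p n)
    (hab : n 0 = a * p + b) (hb : b < p) :
    (b = 0 →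
      MinimallyGeneratesDer (semigroupRing k (projSemigroup p n))
        ({derU k 0 1, derU k (a * n p + d) ((d - 1) * (n p - 1)), derT k 1 0} ∪
          {D | ∃ i ∈ Set.Icc 1 (p - 1),
            D = derT k (a * n p - n (p - i) + 1) (d * (n p - i))})) ∧
    (b = 1 →
      MinimallyGeneratesDer (semigroupRing k (projSemigroup p n))
        ({derU k 0 1, derU k (a * n p + d) ((d - 1) * (n p - 1)), derT k 1 0} ∪
          {D | ∃ i ∈ Set.Icc 1 p,
            D = derT k (a * n p - n (p - i) + 1) (d * (n p - i))})) ∧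
    (b ≠ 0 → b ≠ 1 →
      MinimallyGeneratesDer (semigroupRing k (projSemigroup p n))
        ({derU k 0 1, derU k ((a + 1) * n p + d) ((d - 1) * (n p - 1)), derT k 1 0} ∪
          {D | ∃ i ∈ Set.Icc 1 (b - 1),
            D = derT k (a * n p + i * d + 1) (d * (n p - i))})) := by
  have h := isCoprimeArith_of_gcd (by omega) hpos hn hgcd
  have hp0 := le_of_isMinimalSeq hpos hn hmin
  have hlt := h.lt_last hd
  have hN := h.hn p le_rfl
  have hNz := h.cast_last
  have ha : 0 < a := by
    rcases Nat.eq_zero_or_pos a with rfl | h0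
    · omega
    · exact h0
  obtain ⟨J, hJ⟩ : ∃ J, a + d = J + 1 := ⟨a + d - 1, by omega⟩
  have hJz : (a : ℤ) + d = J + 1 := by exact_mod_cast hJ
  have hNJ : n p = J * p + p + b := by
    rw [hN, hab]
    linear_combination p * hJ
  have hNJ' : n p = (a + d) * p + b := by rw [hJ, hNJ]; ring
  have castx (i : ℕ) (hi : i ≤ p) : ((a * n p - n (p - i) + 1 : ℕ) : ℤ) =
      J * n p - (n p - i) * d + 1 := by
    have h1 := h.hn (p - i) (by omega)
    -- The natural subtraction in the exponent is not truncated, because a ≥ 1.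
    have hle : n (p - i) ≤ a * n p := by
      calc n (p - i) ≤ n p := by
            rw [h1, hN]; exact Nat.add_le_add_left (Nat.mul_le_mul_right _ (by omega)) _
        _ ≤ a * n p := Nat.le_mul_of_pos_left _ ha
    push_cast [hle]
    rw [h1]
    push_cast [hi]
    linear_combination (n p : ℤ) * hJz + hNz
  have casty (i : ℕ) (hi : i ≤ p) : ((d * (n p - i) : ℕ) : ℤ) = (n p - i) * d := by
    push_cast [show i ≤ n p by omega]
    ring
  have castuy : (((d - 1) * (n p - 1) : ℕ) : ℤ) = (n p - 1) * d - n p + 1 := by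
    push_cast [show 1 ≤ d from hd, show 1 ≤ n p by omega]
    ring
  have expand : (J + 1) * p = J * p + p := by ring
  refine ⟨fun hb0 => ?_, fun hb1 => ?_, fun hb0 hb1 => ?_⟩
  · refine h.minimallyGeneratesDer k hd hp0.le (J := J) (by omega) (by omega) _ ?_
      (fun i => a * n p - n (p - i) + 1) (fun i => d * (n p - i))
      (fun i hi => castx i (by have := hi.2; omega)) (fun i hi => casty i (by have := hi.2; omega))
      _ _ ?_ castuy
    · intro i
      rw [Set.mem_Icc]
      omega
    · push_cast
      linear_combination (n p : ℤ) * hJz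
  · refine h.minimallyGeneratesDer k hd hp0.le (J := J) (by omega) (by omega) _ ?_
      (fun i => a * n p - n (p - i) + 1) (fun i => d * (n p - i))
      (fun i hi => castx i hi.2) (fun i hi => casty i hi.2) _ _ ?_ castuy
    · intro i
      rw [Set.mem_Icc]
      omega
    · push_cast
      linear_combination (n p : ℤ) * hJz
  -- For b ≥ 2 the remainder passes the threshold n_p - 1 > (a + d)p, so J goes up by one to a + d.
  · have expand' : (a + d + 1) * p = (a + d) * p + p := by ring
    refine h.minimallyGeneratesDer k hd hp0.le (J := a + d) (by omega) (by omega) _ ?_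
      (fun i => a * n p + i * d + 1) (fun i => d * (n p - i))
      (fun i hi => ?_) (fun i hi => casty i (by have := hi.2; omega)) _ _ ?_ castuy
    · intro i
      rw [Set.mem_Icc]
      omega
    · push_cast
      ring
    · push_cast
      ring
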